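/- Here a graph is a finite, non-empty, connected multigraph without loop edges. For a graph $G$ with vertex set $V(G)$ and edge set $E(G)$, let $\operatorname{Div}(G)$ be the free abelian group on $V(G)$; write a divisor as $D=\sum_{x\in V(G)} D(x)(x)$, put $\deg(D)=\sum_x D(x)$, and call $D$ effective, written $D\ge 0$, if $D(x)\ge 0$ for all $x$. For $f:V(G)\to\mathbb{Z}$ let $\operatorname{div}(f)=\sum_{x\in V(G)}\sum_{e=xy\in E(G)}(f(x)-f(y))\,(x)$, and write $D\sim D'$ if $D-D'=\operatorname{div}(f)$ for some $f$. Let $|D|=\{E\in\operatorname{Div}(G): E\ge 0,\ E\sim D\}$. Define $r(D)=-1$ if $|D|=\emptyset$, and otherwise let $r(D)$ be the largest integer $k$ such that $|D-E|\neq\emptyset$ for every effective divisor $E$ of degree $k$. The graph $G$ is called hyperelliptic if there is a divisor $D$ on $G$ with $\deg(D)=2$ and $r(D)=1$. For a positive integer $k$, let $\sigma_k(G)$ be the graph obtained from $G$ by replacing each edge by a path consisting of $k$ edges. **Corollary.** Let $G$ be a graph and let $k$ be a positive integer. Then $G$ is hyperelliptic if and only if $\sigma_k(G)$ is hyperelliptic.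 -/

import Mathlib

open scoped Graph

noncomputable section

namespace Graph

variable {α β : Type*}

/-- Divisors on a finite graph `G`: the free abelian group `ℤ^V(G)` on the vertices of `G`. -/
abbrev Divisor (G : Graph α β) : Type _ := V(G) → ℤ

/-- The degree of a divisor. -/
def divisorDegree (G : Graph α β) (D : G.Divisor) : ℤ := ∑ᶠ x, D x

/-- The divisor of an integer-valued function `f` on the vertices: its coefficient at `x` is the
sum of `f x - f y` over the edges `e = xy` incident to `x`, counted with multiplicity. -/
def divisorOf (G : Graph α β) (f : V(G) → ℤ) : G.Divisor := fun x =>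
  ∑ᶠ p : {p : E(G) × V(G) // G.IsLink p.1 x p.2}, (f x - f p.1.2)

/-- Linear equivalence of divisors: the difference is principal. -/
def LinearlyEquivalent (G : Graph α β) (D D' : G.Divisor) : Prop :=
  ∃ f : V(G) → ℤ, D - D' = G.divisorOf f

/-- The complete linear system `|D|`: the effective divisors linearly equivalent to `D`. -/
def linearSystem (G : Graph α β) (D : G.Divisor) : Set G.Divisor :=
  {E | 0 ≤ E ∧ G.LinearlyEquivalent E D}

/-- The effective divisors of degree `k`. -/
def effectiveDivisors (G : Graph α β) (k : ℤ) : Set G.Divisor :=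
  {E | 0 ≤ E ∧ G.divisorDegree E = k}

open Classical in
/-- The rank `r(D)`: it is `-1` if `|D|` is empty, and otherwise the largest integer `k` such that
`|D - E|` is non-empty for every effective divisor `E` of degree `k`. (On a finite non-empty graph
the set is then non-empty and bounded above, so that the supremum in `ℤ` is a maximum.) -/
def rank (G : Graph α β) (D : G.Divisor) : ℤ :=
  if (G.linearSystem D).Nonempty then
    sSup {k : ℤ | ∀ E ∈ G.effectiveDivisors k, (G.linearSystem (D - E)).Nonempty}
  else -1

/-- A graph is hyperelliptic if it has a divisor of degree `2` and rank `1`. -/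
def IsHyperelliptic (G : Graph α β) : Prop :=
  ∃ D : G.Divisor, G.divisorDegree D = 2 ∧ G.rank D = 1

/-- One end of the edge `e`, chosen arbitrarily. -/
def firstEnd (G : Graph α β) (e : E(G)) : V(G) :=
  ⟨(G.exists_isLink_of_mem_edgeSet e.2).choose,
    (G.exists_isLink_of_mem_edgeSet e.2).choose_spec.choose_spec.left_mem⟩

/-- The other end of the edge `e`. -/
def secondEnd (G : Graph α β) (e : E(G)) : V(G) :=
  ⟨(G.exists_isLink_of_mem_edgeSet e.2).choose_spec.choose,
    (G.exists_isLink_of_mem_edgeSet e.2).choose_spec.choose_spec.right_mem⟩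

lemma isLink_firstEnd_secondEnd (G : Graph α β) (e : E(G)) :
    G.IsLink e (G.firstEnd e) (G.secondEnd e) :=
  (G.exists_isLink_of_mem_edgeSet e.2).choose_spec.choose_spec

/-- The `i`-th vertex (`0 ≤ i ≤ k`) of the path of `k` edges that replaces the edge `e`. It starts
at one end of `e`, runs through the new vertices `(e, 1), …, (e, k - 1)`, and stops at the other
end of `e`. -/
def pathVertex (G : Graph α β) (k : ℕ) (e : E(G)) (i : ℕ) : V(G) ⊕ E(G) × Set.Ioo 0 k :=
  if h : i ∈ Set.Ioo 0 k then .inr (e, ⟨i, h⟩)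
  else if i = 0 then .inl (G.firstEnd e)
  else .inl (G.secondEnd e)

/-- The `k`-subdivision `σ_k(G)` (for `k ≥ 1`): every edge `e` of `G` is replaced by a path of
`k` edges `(e, 0), …, (e, k - 1)`, where `(e, i)` joins the `i`-th vertex of the path to
the next one. -/
def subdivision (G : Graph α β) (k : ℕ) :
    Graph (V(G) ⊕ E(G) × Set.Ioo 0 k) (E(G) × Fin k) where
  vertexSet := Set.univ
  edgeSet := Set.univ
  IsLink p u v := s(u, v) = s(G.pathVertex k p.1 p.2, G.pathVertex k p.1 (p.2 + 1))
  isLink_symm _ _ := ⟨fun _ _ h => Sym2.eq_swap.trans h⟩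
  eq_or_eq_of_isLink_of_isLink p u v u' v' h h' := by
    rcases Sym2.eq_iff.1 (h.trans h'.symm) with ⟨h, -⟩ | ⟨h, -⟩
    exacts [.inl h, .inr h]
  edge_mem_iff_exists_isLink p := ⟨fun _ => ⟨_, _, rfl⟩, fun _ => trivial⟩
  left_mem_of_isLink _ _ _ _ := trivial

end Graph

end

/-!
A graph is hyperelliptic exactly when it has a divisor of degree `2` and rank at least `1` but none
of degree `1`: a divisor of degree `1` and rank at least `1` makes any two vertices, hence any two
divisors of the same degree, equivalent. So it suffices to carry divisors of rank at least `1` and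
degree at most `2` between `G` and its subdivision.

Upwards, `k • f` extends linearly to the subdivision without changing its divisor. To bring a chip
to an interior point of an edge `ab`, take `f` and `g` moving a chip to `a` and to `b`. If their
slopes along `ab` differ, the maximum of suitable translates of the two extensions has a kink at the
given point; if the slopes agree, a maximum of translates puts a chip on both `a` and `b`, and these
two chips can be moved inwards.

Downwards, an equivalent divisor has a chip at a vertex of `G`, so at most one of the two chips lies
inside an edge; moving that chip to an end of its edge keeps the rank at least `1`, with `⌊F / k⌋`
as the firing function on `G` when `F` is one on the subdivision.
-/

/-- A multigraph on `V` with edges indexed by `E`, presented by the two ends of each edge. The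
order of the ends is an auxiliary choice. -/
structure Multigraph (V E : Type*) where
  src : E → V
  tgt : E → V

namespace Multigraph

section Laplacian

variable {V E : Type*} [DecidableEq V] [Fintype E] (M : Multigraph V E)

/-- The Laplacian, which sends `f` to the divisor `div(f)`. -/
def laplacian : (V → ℤ) →ₗ[ℤ] V → ℤ where
  toFun f x := ∑ e, ((if M.src e = x then f x - f (M.tgt e) else 0) +
    if M.tgt e = x then f x - f (M.src e) else 0)
  map_add' f g := by
    ext x
    simp only [Pi.add_apply, ← Finset.sum_add_distrib]
    refine Finset.sum_congr rfl fun e _ => ?_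
    split_ifs <;> ring
  map_smul' c f := by
    ext x
    simp only [Pi.smul_apply, smul_eq_mul, RingHom.id_apply, Finset.mul_sum]
    refine Finset.sum_congr rfl fun e _ => ?_
    split_ifs <;> ring

lemma laplacian_apply (f : V → ℤ) (x : V) :
    M.laplacian f x = ∑ e, ((if M.src e = x then f x - f (M.tgt e) else 0) +
      if M.tgt e = x then f x - f (M.src e) else 0) := rfl

lemma laplacian_add_const (f : V → ℤ) (c : ℤ) :
    M.laplacian (f + Function.const V c) = M.laplacian f := by
  ext x
  simp [laplacian_apply]

lemma sum_laplacian [Fintype V] (f : V → ℤ) : ∑ x, M.laplacian f x = 0 := by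
  simp only [laplacian_apply]
  rw [Finset.sum_comm]
  exact Finset.sum_eq_zero fun e _ => by simp [Finset.sum_add_distrib]

variable {M}

lemma laplacian_apply_le_of_le {f h : V → ℤ} (hfh : f ≤ h) {x : V} (hx : f x = h x) :
    M.laplacian h x ≤ M.laplacian f x := by
  refine Finset.sum_le_sum fun e _ => ?_
  have hsrc : f (M.src e) ≤ h (M.src e) := hfh _
  have htgt : f (M.tgt e) ≤ h (M.tgt e) := hfh _
  split_ifs <;> omega

lemma laplacian_sup_le {f g D : V → ℤ} (hf : M.laplacian f ≤ D) (hg : M.laplacian g ≤ D) :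
    M.laplacian (f ⊔ g) ≤ D := fun x => by
  rcases le_total (g x) (f x) with h | h
  · exact (laplacian_apply_le_of_le le_sup_left (sup_of_le_left h).symm).trans (hf x)
  · exact (laplacian_apply_le_of_le le_sup_right (sup_of_le_right h).symm).trans (hg x)

omit [Fintype E] in
lemma le_sub_single_one_iff {F D : V → ℤ} {x : V} :
    F ≤ D - Pi.single x 1 ↔ F ≤ D ∧ F x < D x := by
  refine ⟨fun h => ⟨h.trans (sub_le_self _ (Pi.single_nonneg.2 zero_le_one)), ?_⟩, ?_⟩
  · simpa [Int.le_sub_one_iff] using h x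
  · rintro ⟨h, hx⟩ y
    rcases eq_or_ne y x with rfl | hy
    · simpa [Int.le_sub_one_iff] using hx
    · simpa [hy] using h y

lemma exists_laplacian_le_sub_single_sub_single {D f g : V → ℤ} {x y : V} (hxy : x ≠ y)
    (hf : M.laplacian f ≤ D - Pi.single x 1) (hg : M.laplacian g ≤ D - Pi.single y 1)
    (hslope : f y - f x = g y - g x) :
    ∃ h, M.laplacian h ≤ D - Pi.single x 1 - Pi.single y 1 := by
  set g' := g + Function.const V (f x - g x) with hg'_def
  have hx : g' x = f x := by simp [hg'_def]
  have hy : g' y = f y := by simp [hg'_def]; omega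
  rw [← M.laplacian_add_const g (f x - g x), ← hg'_def] at hg
  rw [le_sub_single_one_iff] at hf hg
  refine ⟨f ⊔ g', ?_⟩
  rw [le_sub_single_one_iff, le_sub_single_one_iff, Pi.sub_apply, Pi.single_eq_of_ne' hxy, sub_zero]
  exact ⟨⟨laplacian_sup_le hf.1 hg.1,
    (laplacian_apply_le_of_le le_sup_left (sup_of_le_left hx.le).symm).trans_lt hf.2⟩,
    (laplacian_apply_le_of_le le_sup_right (sup_of_le_right hy.ge).symm).trans_lt hg.2⟩

end Laplacian

section Rank

variable {V E : Type*} [DecidableEq V] [Fintype E] (M : Multigraph V E)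

/-- A divisor is winnable if it is linearly equivalent to an effective one. -/
def IsWinnable (D : V → ℤ) : Prop := ∃ f, M.laplacian f ≤ D

/-- The rank of `D` is at least `r`: removing any effective divisor of degree `r` leaves a winnable
divisor. -/
def RankAtLeast [Fintype V] (D : V → ℤ) (r : ℤ) : Prop :=
  ∀ F, 0 ≤ F → ∑ x, F x = r → M.IsWinnable (D - F)

/-- There is a divisor of degree `d` and rank at least `1`. -/
def HasPencil [Fintype V] (d : ℤ) : Prop :=
  ∃ D : V → ℤ, ∑ x, D x = d ∧ ∀ x, M.IsWinnable (D - Pi.single x 1)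

variable {M} {D : V → ℤ}

lemma IsWinnable.mono {D' : V → ℤ} (h : M.IsWinnable D) (hD : D ≤ D') : M.IsWinnable D' :=
  h.imp fun _ hf => hf.trans hD

lemma IsWinnable.sub_laplacian (h : M.IsWinnable D) (f : V → ℤ) :
    M.IsWinnable (D - M.laplacian f) := by
  obtain ⟨g, hg⟩ := h
  exact ⟨g - f, by rw [map_sub]; exact sub_le_sub_right hg _⟩

variable [Fintype V]

omit [DecidableEq V] in
lemma eq_of_le_of_sum_eq {F F' : V → ℤ} (hle : F ≤ F') (hsum : ∑ x, F x = ∑ x, F' x) : F = F' :=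
  hle.eq_of_not_lt fun hlt => (Fintype.sum_strictMono hlt).ne hsum

lemma IsWinnable.sum_nonneg (h : M.IsWinnable D) : 0 ≤ ∑ x, D x := by
  obtain ⟨f, hf⟩ := h
  exact (M.sum_laplacian f).symm.le.trans (Finset.sum_le_sum fun x _ => hf x)

lemma IsWinnable.mem_range_laplacian (h : M.IsWinnable D) (hD : ∑ x, D x = 0) :
    D ∈ M.laplacian.range := by
  obtain ⟨f, hf⟩ := h
  exact ⟨f, eq_of_le_of_sum_eq hf ((M.sum_laplacian f).trans hD.symm)⟩

lemma rankAtLeast_zero_iff : M.RankAtLeast D 0 ↔ M.IsWinnable D := by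
  refine ⟨fun h => by simpa using h 0 le_rfl (by simp), fun h F hF hdeg => ?_⟩
  have hzero : 0 = F := eq_of_le_of_sum_eq hF (by simp [hdeg])
  simpa [← hzero] using h

lemma rankAtLeast_one_iff : M.RankAtLeast D 1 ↔ ∀ x, M.IsWinnable (D - Pi.single x 1) := by
  refine ⟨fun h x => h _ (Pi.single_nonneg.2 zero_le_one) (by simp), fun h F hF hdeg => ?_⟩
  obtain ⟨x, -, hx⟩ := Finset.exists_ne_zero_of_sum_ne_zero (hdeg.trans_ne one_ne_zero)
  have hle : Pi.single x 1 ≤ F :=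
    update_le_iff.2 ⟨Int.add_one_le_of_lt ((hF x).lt_of_ne' hx), fun y _ => hF y⟩
  have hsingle : Pi.single x 1 = F := eq_of_le_of_sum_eq hle (by simp [hdeg])
  exact hsingle ▸ h x

lemma RankAtLeast.sub {F : V → ℤ} {r s : ℤ} (h : M.RankAtLeast D (r + s)) (hF : 0 ≤ F)
    (hdeg : ∑ x, F x = s) : M.RankAtLeast (D - F) r := fun F' hF' hdeg' => by
  rw [sub_sub, add_comm]
  exact h _ (add_nonneg hF' hF) (by simp [Finset.sum_add_distrib, hdeg, hdeg'])

lemma RankAtLeast.anti [Nonempty V] {r s : ℤ} (hrs : r ≤ s) (h : M.RankAtLeast D s) :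
    M.RankAtLeast D r := fun F hF hdeg => by
  obtain ⟨x⟩ := ‹Nonempty V›
  have hnonneg : 0 ≤ (Pi.single x (s - r) : V → ℤ) := Pi.single_nonneg.2 (by omega)
  exact (h (F + Pi.single x (s - r)) (add_nonneg hF hnonneg)
    (by simp [Finset.sum_add_distrib, hdeg])).mono
    (sub_le_sub_left (le_add_of_nonneg_right hnonneg) _)

lemma RankAtLeast.le_max [Nonempty V] {r : ℤ} (h : M.RankAtLeast D r) :
    r ≤ max 0 (∑ x, D x) := by
  obtain ⟨x⟩ := ‹Nonempty V›
  by_contra! hr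
  have hdeg := (h (Pi.single x r) (Pi.single_nonneg.2 (by omega)) (by simp)).sum_nonneg
  simp only [Pi.sub_apply, Finset.sum_sub_distrib, Fintype.sum_pi_single'] at hdeg
  omega

lemma HasPencil.mem_range_laplacian (h : M.HasPencil 1) (hD : ∑ x, D x = 0) :
    D ∈ M.laplacian.range := by
  obtain ⟨B, hB, hwin⟩ := h
  have hpoint (x : V) : B - Pi.single x 1 ∈ M.laplacian.range :=
    (hwin x).mem_range_laplacian (by simp [hB])
  have hcomb : D = -∑ x, D x • (B - Pi.single x 1) := by
    simp only [smul_sub, Finset.sum_sub_distrib, ← Finset.sum_smul, hD, zero_smul, zero_sub,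
      neg_neg]
    ext y
    simp [Finset.sum_apply, Pi.single_apply]
  rw [hcomb]
  exact neg_mem (sum_mem fun x _ => Submodule.smul_mem _ _ (hpoint x))

lemma HasPencil.rankAtLeast (h : M.HasPencil 1) : M.RankAtLeast D (∑ x, D x) := fun F _ hdeg => by
  obtain ⟨f, hf⟩ := h.mem_range_laplacian (D := D - F) (by simp [hdeg])
  exact ⟨f, hf.le⟩

end Rank

section Presentation

variable {α β V E : Type*}

/-- An identification of a graph `G` with the multigraph `M`, through which statements about `G`
become statements about `M`. -/
structure Presentation (M : Multigraph V E) (G : Graph α β) where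
  vertexEquiv : V ≃ V(G)
  edgeEquiv : E ≃ E(G)
  isLink : ∀ e, G.IsLink (edgeEquiv e) (vertexEquiv (M.src e)) (vertexEquiv (M.tgt e))

namespace Presentation

variable {M : Multigraph V E} {G : Graph α β} (P : M.Presentation G)

lemma isLink_iff (e : E) (x y : V) : G.IsLink (P.edgeEquiv e) (P.vertexEquiv x) (P.vertexEquiv y) ↔
    M.src e = x ∧ M.tgt e = y ∨ M.tgt e = x ∧ M.src e = y := by
  have hinj {u v : V} (h : (P.vertexEquiv u : α) = P.vertexEquiv v) : v = u :=
    (P.vertexEquiv.injective (Subtype.ext h)).symm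
  constructor
  · intro h
    exact (h.eq_and_eq_or_eq_and_eq (P.isLink e)).imp (.imp hinj hinj) (.imp hinj hinj)
  · rintro (⟨rfl, rfl⟩ | ⟨rfl, rfl⟩)
    exacts [P.isLink e, (P.isLink e).symm]

lemma divisorDegree_eq_sum [Fintype V] (D : G.Divisor) :
    G.divisorDegree D = ∑ x, D (P.vertexEquiv x) := by
  rw [Graph.divisorDegree, ← finsum_comp_equiv P.vertexEquiv, finsum_eq_sum_of_fintype]

variable [DecidableEq V] [Fintype E]

lemma divisorOf_apply [Finite V] (f : V(G) → ℤ) (x : V) :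
    G.divisorOf f (P.vertexEquiv x) = M.laplacian (f ∘ P.vertexEquiv) x := by
  classical
  have := Fintype.ofFinite V
  let reindex : {p : E × V // G.IsLink (P.edgeEquiv p.1) (P.vertexEquiv x) (P.vertexEquiv p.2)} ≃
      {p : E(G) × V(G) // G.IsLink p.1 (P.vertexEquiv x) p.2} :=
    (P.edgeEquiv.prodCongr P.vertexEquiv).subtypeEquiv fun _ => Iff.rfl
  rw [Graph.divisorOf, ← finsum_comp_equiv reindex, finsum_eq_sum_of_fintype]
  change ∑ p : {p : E × V // _}, (f (P.vertexEquiv x) - f (P.vertexEquiv p.1.2)) = _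
  rw [← Finset.sum_subtype
    (Finset.univ.filter fun p : E × V =>
      G.IsLink (P.edgeEquiv p.1) (P.vertexEquiv x) (P.vertexEquiv p.2))
    (by simp) (fun p : E × V => f (P.vertexEquiv x) - f (P.vertexEquiv p.2)),
    Finset.sum_filter, Fintype.sum_prod_type, laplacian_apply]
  refine Finset.sum_congr rfl fun e _ => ?_
  simp only [P.isLink_iff, Function.comp_apply]
  by_cases hsrc : M.src e = x <;> by_cases htgt : M.tgt e = x <;> simp [hsrc, htgt]

lemma linearSystem_nonempty_iff [Finite V] (D : G.Divisor) :
    (G.linearSystem D).Nonempty ↔ M.IsWinnable (D ∘ P.vertexEquiv) := by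
  constructor
  · rintro ⟨F, hF, f, hf⟩
    refine ⟨-(f ∘ P.vertexEquiv), fun x => ?_⟩
    have hequiv := congrFun hf (P.vertexEquiv x)
    have heffective := hF (P.vertexEquiv x)
    simp only [P.divisorOf_apply, Pi.sub_apply, Pi.zero_apply, map_neg, Pi.neg_apply,
      Function.comp_apply] at hequiv heffective ⊢
    linarith
  · rintro ⟨f, hf⟩
    refine ⟨D - G.divisorOf (f ∘ P.vertexEquiv.symm), fun y => ?_, -(f ∘ P.vertexEquiv.symm), ?_⟩
    · obtain ⟨x, rfl⟩ := P.vertexEquiv.surjective y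
      simpa [P.divisorOf_apply, Function.comp_assoc] using hf x
    · ext y
      obtain ⟨x, rfl⟩ := P.vertexEquiv.surjective y
      have hneg : (-(f ∘ P.vertexEquiv.symm)) ∘ P.vertexEquiv = -f := by ext; simp
      simp [P.divisorOf_apply, hneg, Function.comp_assoc]

variable [Fintype V]

lemma forall_effectiveDivisors_iff (D : G.Divisor) (r : ℤ) :
    (∀ F ∈ G.effectiveDivisors r, (G.linearSystem (D - F)).Nonempty) ↔
      M.RankAtLeast (D ∘ P.vertexEquiv) r := by
  simp only [P.linearSystem_nonempty_iff]
  constructor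
  · intro h F hF hdeg
    have hwin := h (F ∘ P.vertexEquiv.symm)
      ⟨fun x => hF _, by simpa [P.divisorDegree_eq_sum] using hdeg⟩
    convert hwin using 1
    ext x
    simp
  · rintro h F ⟨hF, hdeg⟩
    exact h (F ∘ P.vertexEquiv) (fun x => hF _) (by rw [← hdeg, P.divisorDegree_eq_sum]; rfl)

lemma rank_eq_iff [Nonempty V] (D : G.Divisor) {r : ℤ} (hr : 0 ≤ r) :
    G.rank D = r ↔ M.RankAtLeast (D ∘ P.vertexEquiv) r ∧
      ¬ M.RankAtLeast (D ∘ P.vertexEquiv) (r + 1) := by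
  simp only [Graph.rank, P.forall_effectiveDivisors_iff]
  split_ifs with hwin <;> rw [P.linearSystem_nonempty_iff] at hwin
  · have hbdd : BddAbove {r | M.RankAtLeast (D ∘ P.vertexEquiv) r} := ⟨_, fun _ h => h.le_max⟩
    have hne : {r | M.RankAtLeast (D ∘ P.vertexEquiv) r}.Nonempty :=
      ⟨0, rankAtLeast_zero_iff.2 hwin⟩
    constructor
    · rintro rfl
      exact ⟨Int.csSup_mem hne hbdd, fun h => (le_csSup hbdd h).not_gt (lt_add_one _)⟩
    · rintro ⟨hge, hlt⟩
      refine IsGreatest.csSup_eq ⟨hge, fun s hs => ?_⟩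
      by_contra! hrs
      exact hlt (RankAtLeast.anti (Int.add_one_le_of_lt hrs) hs)
  · exact ⟨fun h => by omega, fun h => absurd (rankAtLeast_zero_iff.1 (h.1.anti hr)) hwin⟩

theorem isHyperelliptic_iff [Nonempty V] (P : M.Presentation G) :
    G.IsHyperelliptic ↔ M.HasPencil 2 ∧ ¬ M.HasPencil 1 := by
  simp only [Graph.IsHyperelliptic, P.rank_eq_iff _ zero_le_one, P.divisorDegree_eq_sum]
  constructor
  · rintro ⟨D, hdeg, hone, htwo⟩
    refine ⟨⟨D ∘ P.vertexEquiv, hdeg, rankAtLeast_one_iff.1 hone⟩, fun hpencil => htwo ?_⟩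
    have hrank : M.RankAtLeast (D ∘ P.vertexEquiv) (∑ x, D (P.vertexEquiv x)) :=
      hpencil.rankAtLeast
    rwa [hdeg] at hrank
  · rintro ⟨⟨D, hdeg, hone⟩, hpencil⟩
    have hD : (D ∘ P.vertexEquiv.symm) ∘ P.vertexEquiv = D := by ext; simp
    refine ⟨D ∘ P.vertexEquiv.symm, by simpa using hdeg, ?_⟩
    rw [hD]
    refine ⟨rankAtLeast_one_iff.2 hone, fun htwo => hpencil ?_⟩
    obtain ⟨x⟩ := ‹Nonempty V›
    exact ⟨D - Pi.single x 1, by simp [hdeg],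
      rankAtLeast_one_iff.1 (htwo.sub (Pi.single_nonneg.2 zero_le_one) (by simp))⟩

end Presentation

end Presentation

section Subdivision

variable {V E : Type*} (M : Multigraph V E) {k : ℕ}

/-- The `i`-th vertex of the path of `k` edges that replaces the edge `e`, defined in the same way
as `Graph.pathVertex`. -/
def path (k : ℕ) (e : E) (i : ℕ) : V ⊕ E × Set.Ioo 0 k :=
  if h : i ∈ Set.Ioo 0 k then .inr (e, ⟨i, h⟩)
  else if i = 0 then .inl (M.src e)
  else .inl (M.tgt e)

/-- The `k`-subdivision (for `k ≥ 1`), defined in the same way as `Graph.subdivision`. -/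
def subdivision (k : ℕ) : Multigraph (V ⊕ E × Set.Ioo 0 k) (E × Fin k) where
  src p := M.path k p.1 p.2
  tgt p := M.path k p.1 (p.2 + 1)

lemma path_zero (e : E) : M.path k e 0 = .inl (M.src e) := by simp [path]

lemma path_self (hk : 0 < k) (e : E) : M.path k e k = .inl (M.tgt e) := by
  simp [path, hk.ne']

lemma path_coe (e : E) (i : Set.Ioo 0 k) : M.path k e i = .inr (e, i) := by
  simp only [path, dif_pos i.2]

variable {M}

lemma path_eq_inr_iff {e e' : E} {j : ℕ} {i : Set.Ioo 0 k} :
    M.path k e j = .inr (e', i) ↔ e = e' ∧ j = i := by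
  constructor
  · unfold path
    split_ifs with hj
    · rintro ⟨⟩
      exact ⟨rfl, rfl⟩
    all_goals rintro ⟨⟩
  · rintro ⟨rfl, rfl⟩
    exact M.path_coe e i

lemma path_eq_inl_iff_of_lt {e : E} {j : ℕ} (hj : j < k) {v : V} :
    M.path k e j = .inl v ↔ j = 0 ∧ M.src e = v := by
  rcases Nat.eq_zero_or_pos j with rfl | hpos
  · simp [path_zero]
  · simp [M.path_coe e ⟨j, hpos, hj⟩, hpos.ne']

lemma path_succ_eq_inl_iff_of_lt {e : E} {j : ℕ} (hj : j < k) {v : V} :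
    M.path k e (j + 1) = .inl v ↔ j = k - 1 ∧ M.tgt e = v := by
  rcases (Nat.succ_le_of_lt hj).eq_or_lt with rfl | hlt
  · simp [path_self]
  · have hne : j ≠ k - 1 := by omega
    simp [M.path_coe e ⟨j + 1, j.succ_pos, hlt⟩, hne]

variable [DecidableEq V] [DecidableEq E] [Fintype E]

lemma laplacian_subdivision_inl (hk : 0 < k) (F : V ⊕ E × Set.Ioo 0 k → ℤ) (v : V) :
    (M.subdivision k).laplacian F (.inl v) =
      ∑ e, ((if M.src e = v then F (.inl v) - F (M.path k e 1) else 0) +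
        if M.tgt e = v then F (.inl v) - F (M.path k e (k - 1)) else 0) := by
  simp only [laplacian_apply, subdivision, Fintype.sum_prod_type, Finset.sum_add_distrib]
  congr! 2 with e - e -
  · rw [Fintype.sum_eq_single ⟨0, hk⟩]
    · simp [path_zero]
    · intro j hj
      rw [if_neg]
      rw [path_eq_inl_iff_of_lt j.2]
      exact fun h => hj (Fin.ext h.1)
  · rw [Fintype.sum_eq_single ⟨k - 1, by omega⟩]
    · simp [Nat.sub_add_cancel hk, path_self _ hk]
    · intro j hj
      rw [if_neg]
      rw [path_succ_eq_inl_iff_of_lt j.2]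
      exact fun h => hj (Fin.ext h.1)

lemma laplacian_subdivision_inr (F : V ⊕ E × Set.Ioo 0 k → ℤ) (e : E) (i : Set.Ioo 0 k) :
    (M.subdivision k).laplacian F (.inr (e, i)) =
      2 * F (M.path k e i) - F (M.path k e (i - 1)) - F (M.path k e (i + 1)) := by
  have hpos : 0 < (i : ℕ) := i.2.1
  have hlt : (i : ℕ) < k := i.2.2
  simp only [laplacian_apply, subdivision, Fintype.sum_prod_type, path_eq_inr_iff]
  rw [Fintype.sum_eq_single e fun e' he => by simp [he], Finset.sum_add_distrib,
    Fintype.sum_eq_single ⟨i, hlt⟩ fun j hj => if_neg fun h => hj (Fin.ext h.2),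
    Fintype.sum_eq_single ⟨i - 1, by omega⟩ fun j hj => if_neg fun h => hj (Fin.ext (by
      simp only; omega))]
  simp only [Nat.sub_add_cancel hpos, path_coe, and_self, if_true]
  ring

end Subdivision

section Interpolation

variable {V E : Type*} (M : Multigraph V E) {k : ℕ}

/-- The extension of `k • f` to the `k`-subdivision that is linear along the edges. -/
def interpolate (k : ℕ) (f : V → ℤ) : V ⊕ E × Set.Ioo 0 k → ℤ :=
  Sum.elim (fun v => k * f v) fun p =>
    (k - (p.2 : ℕ)) * f (M.src p.1) + (p.2 : ℕ) * f (M.tgt p.1)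

/-- The firing function that moves a chip from each end of the edge `e` inwards until one of them
arrives at the `i`-th vertex of its path and the other one at the `(k - i)`-th. -/
def tent [DecidableEq E] (e : E) (i : Set.Ioo 0 k) : V ⊕ E × Set.Ioo 0 k → ℤ :=
  Sum.elim 0 fun p =>
    if p.1 = e then -min (min ((p.2 : ℕ) : ℤ) (k - (p.2 : ℕ))) (min ((i : ℕ) : ℤ) (k - (i : ℕ)))
    else 0

lemma interpolate_path (hk : 0 < k) (f : V → ℤ) (e : E) {i : ℕ} (hi : i ≤ k) :
    M.interpolate k f (M.path k e i) = (k - i) * f (M.src e) + i * f (M.tgt e) := by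
  rcases Nat.eq_zero_or_pos i with rfl | hpos
  · simp [path_zero, interpolate]
  rcases hi.eq_or_lt with rfl | hlt
  · simp [path_self _ hk, interpolate]
  · simp [M.path_coe e ⟨i, hpos, hlt⟩, interpolate]

lemma tent_path [DecidableEq E] (e e' : E) (i : Set.Ioo 0 k) {j : ℕ} (hj : j ≤ k) :
    tent e i (M.path k e' j) =
      if e' = e then -min (min (j : ℤ) (k - j)) (min ((i : ℕ) : ℤ) (k - (i : ℕ))) else 0 := by
  have hipos : 0 < (i : ℕ) := i.2.1
  have hilt : (i : ℕ) < k := i.2.2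
  rcases Nat.eq_zero_or_pos j with rfl | hpos
  · simp only [path_zero, tent, Sum.elim_inl, Pi.zero_apply]
    split_ifs <;> omega
  rcases hj.eq_or_lt with rfl | hlt
  · simp only [path_self _ hpos, tent, Sum.elim_inl, Pi.zero_apply]
    split_ifs <;> omega
  · simp [M.path_coe e' ⟨j, hpos, hlt⟩, tent]

variable [DecidableEq V] [DecidableEq E] [Fintype E]

lemma laplacian_interpolate (hk : 0 < k) (f : V → ℤ) :
    (M.subdivision k).laplacian (M.interpolate k f) = Sum.elim (M.laplacian f) 0 := by
  ext (v | ⟨e, i⟩)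
  · rw [laplacian_subdivision_inl hk, Sum.elim_inl, laplacian_apply]
    refine Finset.sum_congr rfl fun e _ => ?_
    rw [M.interpolate_path hk f e hk, M.interpolate_path hk f e (Nat.sub_le k 1)]
    push_cast [Nat.cast_sub hk]
    simp only [interpolate, Sum.elim_inl]
    congr 1 <;> split_ifs with h <;> first | rfl | (subst h; ring)
  · have hpos : 0 < (i : ℕ) := i.2.1
    have hlt : (i : ℕ) < k := i.2.2
    rw [laplacian_subdivision_inr, M.interpolate_path hk f e hlt.le,
      M.interpolate_path hk f e hlt, M.interpolate_path hk f e (by omega)]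
    push_cast [Nat.cast_sub hpos]
    simp only [Sum.elim_inr, Pi.zero_apply]
    ring

lemma laplacian_tent_inl (hk : 0 < k) (e : E) (i : Set.Ioo 0 k) (v : V) :
    (M.subdivision k).laplacian (tent e i) (.inl v) =
      (if M.src e = v then 1 else 0) + if M.tgt e = v then 1 else 0 := by
  have hipos : 0 < (i : ℕ) := i.2.1
  have hilt : (i : ℕ) < k := i.2.2
  have hzero : tent (V := V) e i (.inl v) = 0 := rfl
  rw [laplacian_subdivision_inl hk, Fintype.sum_eq_single e]
  · rw [hzero, M.tent_path e e i hk, M.tent_path e e i (Nat.sub_le k 1)]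
    push_cast [Nat.cast_sub hk]
    congr 2 <;> simp only [if_true] <;> omega
  · intro e' he
    rw [hzero, M.tent_path e e' i hk, M.tent_path e e' i (Nat.sub_le k 1)]
    simp [he]

lemma laplacian_tent_inr_le (e e' : E) (i j : Set.Ioo 0 k) :
    (M.subdivision k).laplacian (tent e i) (.inr (e', j)) ≤ if e' = e ∧ j = i then -1 else 0 := by
  have hjpos : 0 < (j : ℕ) := j.2.1
  have hjlt : (j : ℕ) < k := j.2.2
  rw [laplacian_subdivision_inr, M.tent_path e e' i hjlt.le, M.tent_path e e' i hjlt,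
    M.tent_path e e' i (by omega)]
  push_cast [Nat.cast_sub hjpos]
  by_cases he : e' = e
  · simp only [he, if_true, true_and, Subtype.ext_iff]
    split_ifs <;> omega
  · simp [he]

lemma laplacian_tent_le (hk : 0 < k) (e : E) (i : Set.Ioo 0 k) :
    (M.subdivision k).laplacian (tent e i) ≤
      Sum.elim (Pi.single (M.src e) 1 + Pi.single (M.tgt e) 1) (0 : E × Set.Ioo 0 k → ℤ) -
        Pi.single (.inr (e, i)) 1 := by
  rintro (v | ⟨e', j⟩)
  · simp [M.laplacian_tent_inl hk, Pi.single_apply, eq_comm]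
  · refine (M.laplacian_tent_inr_le e e' i j).trans_eq ?_
    simp [Pi.single_apply, apply_ite Neg.neg]

variable {M} {D : V → ℤ}

lemma isWinnable_subdivision_of_slope_ne (hk : 0 < k) {f g : V → ℤ} (hf : M.laplacian f ≤ D)
    (hg : M.laplacian g ≤ D) {e : E}
    (hslope : f (M.tgt e) - f (M.src e) ≠ g (M.tgt e) - g (M.src e)) (i : Set.Ioo 0 k) :
    (M.subdivision k).IsWinnable (Sum.elim D 0 - Pi.single (.inr (e, i)) 1) := by
  set F := M.interpolate k f with hF_def
  set H := M.interpolate k g + Function.const _ (F (.inr (e, i)) - M.interpolate k g (.inr (e, i)))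
    with hH_def
  have hF : (M.subdivision k).laplacian F ≤ Sum.elim D 0 := by
    rw [laplacian_interpolate _ hk]
    exact Sum.elim_le_elim_iff.2 ⟨hf, le_rfl⟩
  have hH : (M.subdivision k).laplacian H ≤ Sum.elim D 0 := by
    rw [laplacian_add_const, laplacian_interpolate _ hk]
    exact Sum.elim_le_elim_iff.2 ⟨hg, le_rfl⟩
  refine ⟨F ⊔ H, le_sub_single_one_iff.2 ⟨laplacian_sup_le hF hH, ?_⟩⟩
  have hpos : 0 < (i : ℕ) := i.2.1
  have hlt : (i : ℕ) < k := i.2.2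
  have hpath (j : ℕ) (hj : j ≤ k) :
      F (M.path k e j) = F (.inr (e, i)) + (j - (i : ℕ)) * (f (M.tgt e) - f (M.src e)) ∧
      H (M.path k e j) = F (.inr (e, i)) + (j - (i : ℕ)) * (g (M.tgt e) - g (M.src e)) := by
    simp only [hH_def, hF_def, Pi.add_apply, Function.const_apply,
      M.interpolate_path hk _ e hj]
    simp only [interpolate, Sum.elim_inr]
    constructor <;> ring
  rw [laplacian_subdivision_inr]
  simp only [Pi.sup_apply, hpath _ hlt.le, hpath (i - 1) (by omega), hpath (i + 1) hlt]
  push_cast [Nat.cast_sub hpos]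
  simp only [Sum.elim_inr, Pi.zero_apply, sub_self, zero_mul, sub_sub_cancel_left,
    add_sub_cancel_left, one_mul, neg_mul]
  omega

lemma isWinnable_subdivision_of_isWinnable_sub_single_sub_single (hk : 0 < k) {e : E}
    (h : M.IsWinnable (D - Pi.single (M.src e) 1 - Pi.single (M.tgt e) 1)) (i : Set.Ioo 0 k) :
    (M.subdivision k).IsWinnable (Sum.elim D 0 - Pi.single (.inr (e, i)) 1) := by
  obtain ⟨f, hf⟩ := h
  have hinterpolate : (M.subdivision k).laplacian (M.interpolate k f) ≤
      Sum.elim (D - Pi.single (M.src e) 1 - Pi.single (M.tgt e) 1) (0 : E × Set.Ioo 0 k → ℤ) := by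
    rw [laplacian_interpolate _ hk]
    exact Sum.elim_le_elim_iff.2 ⟨hf, le_rfl⟩
  refine ⟨M.interpolate k f + tent e i, ?_⟩
  rw [map_add]
  refine (add_le_add hinterpolate (M.laplacian_tent_le hk e i)).trans_eq ?_
  ext (v | p)
  · simp
  · simp

variable [Fintype V]

theorem HasPencil.subdivision (hloop : ∀ e, M.src e ≠ M.tgt e) (hk : 0 < k) {d : ℤ}
    (h : M.HasPencil d) : (M.subdivision k).HasPencil d := by
  obtain ⟨D, hdeg, hwin⟩ := h
  refine ⟨Sum.elim D 0, by simpa using hdeg, ?_⟩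
  rintro (v | ⟨e, i⟩)
  · obtain ⟨f, hf⟩ := hwin v
    refine ⟨M.interpolate k f, ?_⟩
    rw [laplacian_interpolate _ hk]
    rintro (w | p)
    · simpa [Pi.single_apply] using hf w
    · simp
  · obtain ⟨f, hf⟩ := hwin (M.src e)
    obtain ⟨g, hg⟩ := hwin (M.tgt e)
    by_cases hslope : f (M.tgt e) - f (M.src e) = g (M.tgt e) - g (M.src e)
    · exact isWinnable_subdivision_of_isWinnable_sub_single_sub_single hk
        (exists_laplacian_le_sub_single_sub_single (hloop e) hf hg hslope) i
    · exact isWinnable_subdivision_of_slope_ne hk (le_sub_single_one_iff.1 hf).1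
        (le_sub_single_one_iff.1 hg).1 hslope i

end Interpolation

section Retraction

lemma sum_Ioo_mul_second_difference (h : ℕ → ℤ) {k : ℕ} (hk : 0 < k) :
    ∑ j ∈ Finset.Ioo 0 k, (j : ℤ) * (2 * h j - h (j - 1) - h (j + 1)) =
      k * (h (k - 1) - h k) - (h 0 - h k) := by
  change ∑ j ∈ Finset.Ico 1 k, _ = _
  induction k, hk using Nat.le_induction with
  | base => simp
  | succ n hn ih =>
    rw [Finset.sum_Ico_succ_top hn, ih, Nat.add_sub_cancel]
    push_cast
    ring

lemma sum_Ioo_sub_mul_second_difference (h : ℕ → ℤ) {k : ℕ} (hk : 0 < k) :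
    ∑ j ∈ Finset.Ioo 0 k, ((k : ℤ) - j) * (2 * h j - h (j - 1) - h (j + 1)) =
      k * (h 1 - h 0) - (h k - h 0) := by
  have htelescope : ∑ j ∈ Finset.Ioo 0 k, (2 * h j - h (j - 1) - h (j + 1)) =
      h 1 - h 0 - (h k - h (k - 1)) := by
    change ∑ j ∈ Finset.Ico 1 k, _ = _
    induction k, hk using Nat.le_induction with
    | base => simp
    | succ n hn ih =>
      rw [Finset.sum_Ico_succ_top hn, ih, Nat.add_sub_cancel]
      ring
  simp_rw [sub_mul (k : ℤ)]
  rw [Finset.sum_sub_distrib, ← Finset.mul_sum, htelescope, sum_Ioo_mul_second_difference h hk]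
  ring

lemma sum_subtype_Ioo (φ : ℕ → ℤ) (k : ℕ) :
    ∑ i : Set.Ioo 0 k, φ i = ∑ j ∈ Finset.Ioo 0 k, φ j :=
  (Finset.sum_subtype _ (by simp) φ).symm

lemma eq_of_sum_le_one {ι : Type*} [Fintype ι] {D : ι → ℤ} (hD : 0 ≤ D) (hsum : ∑ x, D x ≤ 1)
    {x y : ι} (hx : D x ≠ 0) (hy : D y ≠ 0) : x = y := by
  classical
  by_contra hxy
  have hpair : D x + D y ≤ ∑ x, D x := by
    rw [← Finset.sum_pair hxy]
    exact Finset.sum_le_univ_sum_of_nonneg hD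
  have hx' : 0 < D x := (hD x).lt_of_ne' hx
  have hy' : 0 < D y := (hD y).lt_of_ne' hy
  omega

variable {V E : Type*} {M : Multigraph V E} {k : ℕ} [DecidableEq V] [DecidableEq E] [Fintype E]

lemma mul_slope_src_eq (hk : 0 < k) (F : V ⊕ E × Set.Ioo 0 k → ℤ) (e : E) :
    k * (F (M.path k e 1) - F (.inl (M.src e))) = F (.inl (M.tgt e)) - F (.inl (M.src e)) +
      ∑ i : Set.Ioo 0 k, (k - (i : ℕ)) * (M.subdivision k).laplacian F (.inr (e, i)) := by
  have hgreen := sum_Ioo_sub_mul_second_difference (fun j => F (M.path k e j)) hk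
  simp only [laplacian_subdivision_inr]
  rw [← sum_subtype_Ioo] at hgreen
  rw [hgreen, path_zero, path_self _ hk]
  ring

lemma mul_slope_tgt_eq (hk : 0 < k) (F : V ⊕ E × Set.Ioo 0 k → ℤ) (e : E) :
    k * (F (M.path k e (k - 1)) - F (.inl (M.tgt e))) =
      F (.inl (M.src e)) - F (.inl (M.tgt e)) +
        ∑ i : Set.Ioo 0 k, (i : ℕ) * (M.subdivision k).laplacian F (.inr (e, i)) := by
  have hgreen := sum_Ioo_mul_second_difference (fun j => F (M.path k e j)) hk
  simp only [laplacian_subdivision_inr]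
  rw [← sum_subtype_Ioo] at hgreen
  rw [hgreen, path_zero, path_self _ hk]
  ring

variable {F C : V ⊕ E × Set.Ioo 0 k → ℤ}

lemma src_ediv_sub_tgt_ediv_le (hk : 0 < k) {e : E} (hC : ∀ i, 0 ≤ C (.inr (e, i)))
    (hF : ∀ i, (M.subdivision k).laplacian F (.inr (e, i)) ≤ C (.inr (e, i))) :
    F (.inl (M.src e)) / k - F (.inl (M.tgt e)) / k ≤
      F (.inl (M.src e)) - F (M.path k e 1) + ∑ i, C (.inr (e, i)) := by
  have hweights : ∑ i : Set.Ioo 0 k, (k - (i : ℕ)) * (M.subdivision k).laplacian F (.inr (e, i)) ≤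
      k * ∑ i, C (.inr (e, i)) := by
    rw [Finset.mul_sum]
    refine Finset.sum_le_sum fun i _ => ?_
    have hle : ((i : ℕ) : ℤ) ≤ k := by exact_mod_cast i.2.2.le
    exact (mul_le_mul_of_nonneg_left (hF i) (sub_nonneg.2 hle)).trans
      (mul_le_mul_of_nonneg_right (sub_le_self _ (Int.natCast_nonneg _)) (hC i))
  have hslope := mul_slope_src_eq (M := M) hk F e
  have hlinear : F (.inl (M.src e)) +
      k * (F (M.path k e 1) - F (.inl (M.src e)) - ∑ i, C (.inr (e, i))) ≤ F (.inl (M.tgt e)) := by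
    rw [mul_sub]
    linarith
  have hk' : (0 : ℤ) < k := by exact_mod_cast hk
  have hfloor := Int.ediv_le_ediv hk' hlinear
  rw [Int.add_mul_ediv_left _ _ hk'.ne'] at hfloor
  linarith

lemma tgt_ediv_sub_src_ediv_le (hk : 0 < k) {e : E}
    (hF : ∀ i, (M.subdivision k).laplacian F (.inr (e, i)) ≤ C (.inr (e, i)))
    (hmod : F (.inl (M.src e)) % k + ∑ i : Set.Ioo 0 k, (i : ℕ) * C (.inr (e, i)) < k) :
    F (.inl (M.tgt e)) / k - F (.inl (M.src e)) / k ≤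
      F (.inl (M.tgt e)) - F (M.path k e (k - 1)) := by
  have hweights : ∑ i : Set.Ioo 0 k, ((i : ℕ) : ℤ) * (M.subdivision k).laplacian F (.inr (e, i)) ≤
      ∑ i : Set.Ioo 0 k, (i : ℕ) * C (.inr (e, i)) :=
    Finset.sum_le_sum fun i _ => mul_le_mul_of_nonneg_left (hF i) (Int.natCast_nonneg _)
  have hslope := mul_slope_tgt_eq (M := M) hk F e
  have hdivision := Int.emod_add_mul_ediv (F (.inl (M.src e))) k
  have hlt : F (.inl (M.tgt e)) < (F (.inl (M.src e)) / k +
      (F (.inl (M.tgt e)) - F (M.path k e (k - 1))) + 1) * k := by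
    linarith
  have hfloor := Int.ediv_lt_of_lt_mul (by exact_mod_cast hk) hlt
  omega

/-- The divisor obtained from a divisor on the subdivision by moving all chips inside an edge to
the vertex at which the edge starts. -/
def retract (M : Multigraph V E) (C : V ⊕ E × Set.Ioo 0 k → ℤ) : V → ℤ := fun v =>
  C (.inl v) + ∑ e, if M.src e = v then ∑ i, C (.inr (e, i)) else 0

omit [DecidableEq E] in
lemma sum_retract [Fintype V] (M : Multigraph V E) (C : V ⊕ E × Set.Ioo 0 k → ℤ) :
    ∑ v, M.retract C v = ∑ x, C x := by
  simp only [retract, Finset.sum_add_distrib, Fintype.sum_sum_type, Fintype.sum_prod_type]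
  rw [Finset.sum_comm]
  simp

lemma laplacian_ediv_add_le_retract (hk : 0 < k) (hC : ∀ p, 0 ≤ C (.inr p))
    (hF : ∀ p, (M.subdivision k).laplacian F (.inr p) ≤ C (.inr p))
    (hmod : ∀ e, F (.inl (M.src e)) % k + ∑ i : Set.Ioo 0 k, (i : ℕ) * C (.inr (e, i)) < k)
    (v : V) : M.laplacian (fun w => F (.inl w) / k) v + C (.inl v) ≤
      M.retract C v + (M.subdivision k).laplacian F (.inl v) := by
  suffices h : M.laplacian (fun w => F (.inl w) / k) v ≤
      (M.subdivision k).laplacian F (.inl v) +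
        ∑ e, if M.src e = v then ∑ i, C (.inr (e, i)) else 0 by
    rw [retract]
    linarith
  rw [laplacian_subdivision_inl hk, laplacian_apply, ← Finset.sum_add_distrib]
  refine Finset.sum_le_sum fun e _ => ?_
  have hsrc := src_ediv_sub_tgt_ediv_le hk (fun i => hC (e, i)) fun i => hF (e, i)
  have htgt := tgt_ediv_sub_src_ediv_le hk (fun i => hF (e, i)) (hmod e)
  rcases eq_or_ne (M.src e) v with hs | hs <;> rcases eq_or_ne (M.tgt e) v with ht | ht <;>
    simp only [hs, ht, if_true, if_false] at hsrc htgt ⊢ <;> linarith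

lemma sum_mul_lt_of_sum_le_one (hk : 0 < k) {c : Set.Ioo 0 k → ℤ} (hc : 0 ≤ c)
    (hsum : ∑ i, c i ≤ 1) : ∑ i : Set.Ioo 0 k, (i : ℕ) * c i < k := by
  have hle : ∑ i : Set.Ioo 0 k, (i : ℕ) * c i ≤ (k - 1) * ∑ i, c i := by
    rw [Finset.mul_sum]
    refine Finset.sum_le_sum fun i _ => mul_le_mul_of_nonneg_right ?_ (hc i)
    have hlt : (i : ℕ) < k := i.2.2
    omega
  have hk' : (0 : ℤ) ≤ k - 1 := by omega
  linarith [mul_le_mul_of_nonneg_left hsum hk']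

lemma isWinnable_retract_sub_single (hk : 0 < k) (hC : ∀ p, 0 ≤ C (.inr p))
    (hsum : ∑ p, C (.inr p) ≤ 1) {v : V}
    (h : (M.subdivision k).IsWinnable (C - Pi.single (.inl v) 1)) :
    M.IsWinnable (M.retract C - Pi.single v 1) := by
  obtain ⟨w, hw⟩ : ∃ w, ∀ p, C (.inr p) ≠ 0 → M.src p.1 = w := by
    by_cases hchip : ∃ p, C (.inr p) ≠ 0
    · obtain ⟨p, hp⟩ := hchip
      exact ⟨M.src p.1, fun q hq => by
        rw [eq_of_sum_le_one (D := fun p => C (.inr p)) hC hsum hq hp]⟩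
    · push Not at hchip
      exact ⟨v, fun p hp => absurd (hchip p) hp⟩
  obtain ⟨F, hF⟩ := h
  wlog hFw : F (.inl w) = 0 generalizing F
  · exact this (F + Function.const _ (-F (.inl w))) (by rwa [laplacian_add_const]) (by simp)
  have hmod (e : E) :
      F (.inl (M.src e)) % k + ∑ i : Set.Ioo 0 k, (i : ℕ) * C (.inr (e, i)) < k := by
    by_cases he : M.src e = w
    · rw [he, hFw, Int.zero_emod, zero_add]
      refine sum_mul_lt_of_sum_le_one hk (fun i => hC (e, i)) (le_trans ?_ hsum)
      rw [Fintype.sum_prod_type]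
      exact Finset.single_le_sum (f := fun e => ∑ i, C (.inr (e, i)))
        (fun e _ => Finset.sum_nonneg fun i _ => hC (e, i)) (Finset.mem_univ e)
    · have hempty (i : Set.Ioo 0 k) : C (.inr (e, i)) = 0 := not_imp_comm.1 (hw (e, i)) he
      simpa [hempty] using Int.emod_lt_of_pos _ (Int.natCast_pos.2 hk)
  refine ⟨fun u => F (.inl u) / k, fun u => ?_⟩
  have hle := laplacian_ediv_add_le_retract hk hC (fun p => by simpa using hF (.inr p)) hmod u
  have hFu := hF (.inl u)
  simp only [Pi.sub_apply, Pi.single_apply, Sum.inl.injEq] at hFu ⊢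
  linarith

theorem HasPencil.of_subdivision [Fintype V] [Nonempty V] (hk : 0 < k) {d : ℤ} (hd : d ≤ 2)
    (h : (M.subdivision k).HasPencil d) : M.HasPencil d := by
  obtain ⟨D, hdeg, hwin⟩ := h
  let x : V := Classical.arbitrary V
  obtain ⟨F, hF⟩ := hwin (.inl x)
  set C := D - (M.subdivision k).laplacian F with hC_def
  have hCdeg : ∑ y, C y = d := by simp [hC_def, sum_laplacian, hdeg]
  have hchip : 0 ≤ C - Pi.single (.inl x) 1 := by
    rw [hC_def, sub_right_comm]
    exact sub_nonneg.2 hF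
  have hinr (p : E × Set.Ioo 0 k) : 0 ≤ C (.inr p) := by simpa using hchip (.inr p)
  have hinl : 0 ≤ ∑ v, (C (.inl v) - (Pi.single x 1 : V → ℤ) v) :=
    Finset.sum_nonneg fun v _ => by simpa [Pi.single_apply] using hchip (.inl v)
  have hsum : ∑ p, C (.inr p) ≤ 1 := by
    rw [Fintype.sum_sum_type] at hCdeg
    rw [Finset.sum_sub_distrib, Fintype.sum_pi_single'] at hinl
    linarith
  refine ⟨M.retract C, (M.sum_retract C).trans hCdeg, fun v => ?_⟩
  refine isWinnable_retract_sub_single hk hinr hsum ?_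
  rw [hC_def, sub_right_comm]
  exact (hwin _).sub_laplacian F

end Retraction

section Graph

variable {α β : Type*} (G : Graph α β)

/-- The multigraph underlying a graph, with the orientation chosen by `Graph.firstEnd` and
`Graph.secondEnd`. -/
noncomputable def ofGraph : Multigraph V(G) E(G) where
  src := G.firstEnd
  tgt := G.secondEnd

/-- The identification of a graph with its underlying multigraph. -/
noncomputable def presentation : (ofGraph G).Presentation G where
  vertexEquiv := Equiv.refl _
  edgeEquiv := Equiv.refl _
  isLink := G.isLink_firstEnd_secondEnd

/-- The identification of the subdivided graph with the subdivided multigraph. -/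
noncomputable def subdivisionPresentation (k : ℕ) :
    ((ofGraph G).subdivision k).Presentation (G.subdivision k) where
  vertexEquiv := (Equiv.Set.univ _).symm
  edgeEquiv := (Equiv.Set.univ _).symm
  isLink _ := rfl

variable {G}

lemma ofGraph_src_ne_tgt (hloop : G.Loopless) (e : E(G)) :
    (ofGraph G).src e ≠ (ofGraph G).tgt e := fun h => by
  have hlink : G.IsLink e (G.firstEnd e) ((ofGraph G).tgt e) := G.isLink_firstEnd_secondEnd e
  rw [← h] at hlink
  exact hloop.not_isLoopAt _ _ hlink

end Graph

end Multigraph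

theorem mainTheorem9_general {α β : Type*} (G : Graph α β) (hV : V(G).Finite) (hE : E(G).Finite)
    (hne : V(G).Nonempty) (hloop : G.Loopless) (k : ℕ) (hk : 0 < k) :
    G.IsHyperelliptic ↔ (G.subdivision k).IsHyperelliptic := by
  classical
  have := hV.fintype
  have := hE.fintype
  have := hne.to_subtype
  have hpencil {d : ℤ} (hd : d ≤ 2) : (Multigraph.ofGraph G).HasPencil d ↔
      ((Multigraph.ofGraph G).subdivision k).HasPencil d :=
    ⟨.subdivision (Multigraph.ofGraph_src_ne_tgt hloop) hk, .of_subdivision hk hd⟩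
  rw [Multigraph.Presentation.isHyperelliptic_iff (Multigraph.presentation G),
    Multigraph.Presentation.isHyperelliptic_iff (Multigraph.subdivisionPresentation G k),
    hpencil le_rfl, hpencil one_le_two]

theorem mainTheorem9 {α β : Type*} (G : Graph α β) (hV : V(G).Finite) (hE : E(G).Finite)
    (hloop : G.Loopless) (hconn : G.toSimpleGraph.Connected) (k : ℕ) (hk : 0 < k) :
    G.IsHyperelliptic ↔ (G.subdivision k).IsHyperelliptic :=
  mainTheorem9_general G hV hE (Set.nonempty_coe_sort.1 hconn.nonempty) hloop k hk
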